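/- Let $(G_i)_{i\in I}$ be a family of finite groups, indexed by an arbitrary set $I$, and let $$G=\Bigl\{(x_i)_{i\in I}\in\prod_{i\in I}G_i : x_i=e_{G_i}\text{ for all but finitely many } i\Bigr\}$$ be their restricted direct product. Every conjugacy class of $G$ is finite. Let $\ell^1(G)$ be the Banach algebra of absolutely summable functions $G\to\mathbb C$ under convolution, $(f*g)(x)=\sum_{y\in G}f(y)g(y^{-1}x)$, and let $\mathrm{Z}\ell^1(G)$ be its centre. Let $\omega$ be an algebra character of $\mathrm{Z}\ell^1(G)$, i.e. a non-zero multiplicative linear functional $\mathrm{Z}\ell^1(G)\to\mathbb C$, and let $\widetilde\omega:G\to\mathbb C$ be the corresponding function, constant on conjugacy classes, given by $$\widetilde\omega(x)=\frac{1}{|C|}\,\omega(1_{C}),\qquad C=\text{the conjugacy class of }x^{-1},$$ so that $\omega(f)=\sum_{x\in G}f(x)\,\widetilde\omega(x^{-1})$ for all $f\in \mathrm{Z}\ell^1(G)$. If $G$ is infinite, then $\widetilde\omega\notin\ell^1(G)$, i.e. $\sum_{x\in G}|\widetilde\omega(x)|=\infty$. -/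

import Mathlib

/-- The space `ℓ¹(G)` of absolutely summable functions `G → ℂ`, with the norm `∑ |f x|`. -/
def EllOne (G : Type*) : Type _ := lp (fun _ : G => ℂ) 1

namespace EllOne

section Space

variable {G : Type*}

noncomputable instance : NormedAddCommGroup (EllOne G) :=
  inferInstanceAs (NormedAddCommGroup (lp (fun _ : G => ℂ) 1))

noncomputable instance : NormedSpace ℂ (EllOne G) :=
  inferInstanceAs (NormedSpace ℂ (lp (fun _ : G => ℂ) 1))

instance : CompleteSpace (EllOne G) :=
  inferInstanceAs (CompleteSpace (lp (fun _ : G => ℂ) 1))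

instance : FunLike (EllOne G) G ℂ where
  coe f := f.1
  coe_injective _ _ h := Subtype.ext h

theorem memlp_one_iff {f : G → ℂ} : Memℓp f 1 ↔ Summable (fun x => ‖f x‖) := by
  rw [memℓp_gen_iff (by norm_num)]
  simp

/-- The element of `ℓ¹(G)` given by an absolutely summable function. -/
def mk (f : G → ℂ) (hf : Summable (fun x => ‖f x‖)) : EllOne G :=
  ⟨f, memlp_one_iff.2 hf⟩

@[simp] theorem mk_apply (f : G → ℂ) (hf : Summable (fun x => ‖f x‖)) (x : G) :
    mk f hf x = f x := rfl

@[ext] theorem ext {f g : EllOne G} (h : ∀ x, f x = g x) : f = g :=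
  DFunLike.ext f g h

theorem summable_norm (f : EllOne G) : Summable (fun x => ‖f x‖) :=
  memlp_one_iff.1 f.2

theorem norm_def (f : EllOne G) : ‖f‖ = ∑' x, ‖f x‖ := by
  have h := lp.norm_eq_tsum_rpow (p := 1) (by norm_num) (show lp (fun _ : G => ℂ) 1 from f)
  simp only [ENNReal.toReal_one, Real.rpow_one, div_one] at h
  exact h

@[simp] theorem add_apply (f g : EllOne G) (x : G) : (f + g) x = f x + g x := rfl
@[simp] theorem zero_apply (x : G) : (0 : EllOne G) x = 0 := rfl
@[simp] theorem smul_apply (c : ℂ) (f : EllOne G) (x : G) : (c • f) x = c * f x := rfl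

theorem norm_apply_le (f : EllOne G) (x : G) : ‖f x‖ ≤ ‖f‖ := by
  rw [norm_def]
  exact (summable_norm f).le_tsum x (fun _ _ => norm_nonneg _)

end Space

section Convolution

variable {G : Type*} [Group G]

theorem summable_pair (f g : EllOne G) :
    Summable (fun p : G × G => ‖f p.1 * g (p.1⁻¹ * p.2)‖) := by
  have h : Summable (fun p : G × G => ‖f p.1 * g p.2‖) := by
    simpa only [norm_mul] using
      (summable_norm f).mul_of_nonneg (summable_norm g) (fun _ => norm_nonneg _)
        (fun _ => norm_nonneg _)
  let e : G × G ≃ G × G :=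
    { toFun := fun p => (p.1, p.1⁻¹ * p.2)
      invFun := fun p => (p.1, p.1 * p.2)
      left_inv := fun p => by simp
      right_inv := fun p => by simp }
  exact (e.summable_iff (f := fun p : G × G => ‖f p.1 * g p.2‖)).2 h

theorem summable_pair_swap (f g : EllOne G) :
    Summable (fun p : G × G => ‖f p.2 * g (p.2⁻¹ * p.1)‖) :=
  ((Equiv.prodComm G G).summable_iff
    (f := fun p : G × G => ‖f p.1 * g (p.1⁻¹ * p.2)‖)).2 (summable_pair f g)

theorem summable_norm_fiber (f g : EllOne G) (x : G) :
    Summable (fun y => ‖f y * g (y⁻¹ * x)‖) :=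
  (summable_pair_swap f g).prod_factor x

theorem summable_fiber (f g : EllOne G) (x : G) :
    Summable (fun y => f y * g (y⁻¹ * x)) :=
  (summable_norm_fiber f g x).of_norm

theorem summable_norm_conv (f g : EllOne G) :
    Summable (fun x => ‖∑' y, f y * g (y⁻¹ * x)‖) :=
  Summable.of_nonneg_of_le (fun _ => norm_nonneg _)
    (fun x => norm_tsum_le_tsum_norm (summable_norm_fiber f g x))
    (summable_pair_swap f g).prod

/-- Multiplication on `ℓ¹(G)` is convolution: `(f * g)(x) = ∑ y, f(y) g(y⁻¹ x)`. -/
noncomputable instance : Mul (EllOne G) :=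
  ⟨fun f g => mk (fun x => ∑' y, f y * g (y⁻¹ * x)) (summable_norm_conv f g)⟩

theorem mul_apply (f g : EllOne G) (x : G) : (f * g) x = ∑' y, f y * g (y⁻¹ * x) := rfl

open Classical in
/-- The identity of `ℓ¹(G)` is the indicator function of the identity element of `G`. -/
noncomputable instance : One (EllOne G) :=
  ⟨mk (fun x => if x = 1 then 1 else 0)
    (summable_of_hasFiniteSupport ((Set.finite_singleton (1 : G)).subset (fun x hx => by
      by_contra h
      exact hx (by simp [show x ≠ 1 from h]))))⟩

open Classical in
theorem one_apply (x : G) : (1 : EllOne G) x = if x = 1 then 1 else 0 := rfl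

protected theorem mul_assoc (f g h : EllOne G) : f * g * h = f * (g * h) := by
  ext x
  have hs : Summable (fun p : G × G => f p.1 * g (p.1⁻¹ * p.2) * h (p.2⁻¹ * x)) := by
    refine Summable.of_norm_bounded ((summable_pair f g).mul_right ‖h‖) (fun p => ?_)
    rw [norm_mul]
    exact mul_le_mul_of_nonneg_left (norm_apply_le h _) (norm_nonneg _)
  calc (f * g * h) x
      = ∑' z, ∑' y, f y * g (y⁻¹ * z) * h (z⁻¹ * x) := by
        rw [mul_apply]
        refine tsum_congr fun z => ?_
        rw [mul_apply, tsum_mul_right]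
    _ = ∑' y, ∑' z, f y * g (y⁻¹ * z) * h (z⁻¹ * x) := Summable.tsum_comm hs
    _ = (f * (g * h)) x := by
        rw [mul_apply]
        refine tsum_congr fun y => ?_
        rw [mul_apply, ← tsum_mul_left,
          ← (Equiv.mulLeft y⁻¹).tsum_eq (fun z => f y * (g z * h (z⁻¹ * (y⁻¹ * x))))]
        refine tsum_congr fun z => ?_
        simp [mul_assoc]

noncomputable instance : NormedRing (EllOne G) :=
  { (inferInstance : NormedAddCommGroup (EllOne G)) with
    mul := (· * ·)
    one := 1
    left_distrib := fun f g h => by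
      ext x
      simp only [mul_apply, add_apply, mul_add]
      exact (summable_fiber f g x).tsum_add (summable_fiber f h x)
    right_distrib := fun f g h => by
      ext x
      simp only [mul_apply, add_apply, add_mul]
      exact (summable_fiber f h x).tsum_add (summable_fiber g h x)
    zero_mul := fun f => by ext x; simp [mul_apply]
    mul_zero := fun f => by ext x; simp [mul_apply]
    mul_assoc := EllOne.mul_assoc
    one_mul := fun f => by
      ext x
      rw [mul_apply, tsum_eq_single 1 (fun y hy => by simp [one_apply, hy])]
      simp [one_apply]
    mul_one := fun f => by
      ext x
      rw [mul_apply, tsum_eq_single x (fun y hy => by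
        rw [one_apply, if_neg (fun h => hy (inv_mul_eq_one.1 h)), mul_zero])]
      simp [one_apply]
    norm_mul_le := fun f g => by
      rw [norm_def, norm_def, norm_def]
      calc ∑' x, ‖(f * g) x‖
          ≤ ∑' x, ∑' y, ‖f y * g (y⁻¹ * x)‖ :=
            (summable_norm_conv f g).tsum_le_tsum
              (fun x => norm_tsum_le_tsum_norm (summable_norm_fiber f g x))
              (summable_pair_swap f g).prod
        _ = ∑' y, ∑' x, ‖f y * g (y⁻¹ * x)‖ := Summable.tsum_comm (summable_pair f g)
        _ = ∑' y, ‖f y‖ * ∑' x, ‖g x‖ := by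
            refine tsum_congr fun y => ?_
            rw [← tsum_mul_left,
              ← (Equiv.mulLeft y⁻¹).tsum_eq (fun x => ‖f y‖ * ‖g x‖)]
            exact tsum_congr fun x => by simp
        _ = (∑' x, ‖f x‖) * ∑' x, ‖g x‖ := tsum_mul_right }

noncomputable instance : NormedAlgebra ℂ (EllOne G) :=
  { Algebra.ofModule
      (fun c f g => by
        ext x
        simp only [mul_apply, smul_apply, mul_assoc, tsum_mul_left])
      (fun c f g => by
        ext x
        simp only [mul_apply, smul_apply, mul_left_comm, tsum_mul_left]) with
    norm_smul_le := fun c f => norm_smul_le c f }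

end Convolution

end EllOne

/-- The centre `Zℓ¹(G)` of the convolution algebra `ℓ¹(G)`. -/
noncomputable abbrev ZEllOne (G : Type*) [Group G] : Subalgebra ℂ (EllOne G) :=
  Subalgebra.center ℂ (EllOne G)

/-- An FC group: every conjugacy class is finite. -/
class IsFCGroup (G : Type*) [Group G] : Prop where
  finite_conjugatesOf : ∀ x : G, (conjugatesOf x).Finite

section ClassFunction

variable {G : Type*} [Group G] [IsFCGroup G]

open Classical in
/-- The indicator function of the (finite) conjugacy class of `x`, as an element of `ℓ¹(G)`. -/
noncomputable def classIndicator (x : G) : EllOne G :=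
  EllOne.mk (fun y => if y ∈ conjugatesOf x then 1 else 0)
    (summable_of_hasFiniteSupport ((IsFCGroup.finite_conjugatesOf x).subset (fun y hy => by
      by_contra h
      exact hy (by simp only [if_neg h, norm_zero]))))

open Classical in
theorem classIndicator_apply (x y : G) :
    classIndicator x y = if y ∈ conjugatesOf x then 1 else 0 := rfl

theorem classIndicator_mul_comm (x a b : G) :
    classIndicator x (a * b) = classIndicator x (b * a) := by
  have h : IsConj (a * b) (b * a) := isConj_iff.2 ⟨b, by group⟩
  have h' : a * b ∈ conjugatesOf x ↔ b * a ∈ conjugatesOf x := by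
    exact ⟨fun k => IsConj.trans k h, fun k => IsConj.trans k h.symm⟩
  classical
  rw [classIndicator_apply, classIndicator_apply, if_congr h' rfl rfl]

theorem classIndicator_mem_center (x : G) : classIndicator x ∈ ZEllOne G := by
  rw [Subalgebra.mem_center_iff]
  intro f
  ext z
  rw [EllOne.mul_apply, EllOne.mul_apply,
    ← ((Equiv.inv G).trans (Equiv.mulLeft z)).tsum_eq
      (fun y => classIndicator x y * f (y⁻¹ * z))]
  refine tsum_congr fun y => ?_
  have h1 : ((Equiv.inv G).trans (Equiv.mulLeft z)) y = z * y⁻¹ := rfl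
  have h2 : (z * y⁻¹)⁻¹ * z = y := by group
  rw [h1, h2, classIndicator_mul_comm x z, mul_comm]

/-- The function `ω̃ : G → ℂ`, constant on conjugacy classes, that corresponds to an algebra
character `ω` of `Zℓ¹(G)`: it is determined by `ω f = ∑ x, f x * ω̃ x⁻¹`, so that
`ω̃ x` is the value of `ω` at the normalised indicator function of the class of `x⁻¹`.
For a finite group and `ω f = ∑ x, f x * (χ 1)⁻¹ * χ x⁻¹` with `χ` an irreducible group
character, this is `ω̃ x = (χ 1)⁻¹ * χ x`. -/
noncomputable def characterFunction (ω : ZEllOne G →ₐ[ℂ] ℂ) (x : G) : ℂ :=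
  ((conjugatesOf x⁻¹).ncard : ℂ)⁻¹ * ω ⟨classIndicator x⁻¹, classIndicator_mem_center x⁻¹⟩

end ClassFunction

open scoped RestrictedProduct in
/-- The restricted direct product of a family of groups: the families `(x i)` with `x i = 1`
for all but finitely many `i`, under the pointwise operations. -/
abbrev RestrictedDirectProduct {ι : Type*} (G : ι → Type*) [∀ i, Group (G i)] : Type _ :=
  Πʳ i, [G i, ((⊥ : Subgroup (G i)) : Set (G i))]

/-- A restricted direct product of finite groups is an FC group. -/
instance {ι : Type*} (G : ι → Type*) [∀ i, Group (G i)] [∀ i, Finite (G i)] :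
    IsFCGroup (RestrictedDirectProduct G) where
  finite_conjugatesOf := fun x => by
    classical
    have hx : {i | x i ≠ 1}.Finite := by
      have h := x.2
      rw [Filter.eventually_cofinite] at h
      exact h
    have : Fintype {i | x i ≠ 1} := hx.fintype
    refine Set.Finite.of_injOn
      (f := fun y : RestrictedDirectProduct G => fun i : {i | x i ≠ 1} => y i.1)
      (t := Set.univ) (fun _ _ => Set.mem_univ _) ?_ Set.finite_univ
    have key : ∀ y ∈ conjugatesOf x, ∀ i, x i = 1 → y i = 1 := by
      intro y hy i hi
      obtain ⟨c, rfl⟩ := isConj_iff.1 (show IsConj x y from hy)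
      simp [hi]
    intro y hy z hz hyz
    ext i
    by_cases hi : x i = 1
    · rw [key y hy i hi, key z hz i hi]
    · exact congrFun hyz ⟨i, hi⟩

/-! ### Characters evaluated on finite normal subgroups. -/

section FiniteNormalSubgroup

variable {G : Type*} [Group G]

/-! Every nontrivial finite normal subgroup `N` carries mass at least `1` of `ω̃` away from the
identity. Indeed `1_N` is central and `ω(1_N) = ∑_{x ∈ N} ω̃(x)`. If this value is zero, then `ω̃(1)
= 1` forces the remaining terms to sum to `-1`. If it is nonzero, then `1_C * 1_N = |C| 1_N` for
each class `C ⊆ N` lets `ω(1_N)` be cancelled, so `ω̃ = 1` on `N`, and any non-identity element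
suffices (`one_le_sum_norm_characterFunction`).

An infinite restricted product of finite groups has infinitely many nontrivial factors. They are
finite normal subgroups meeting pairwise only in the identity, so beyond any finite set of elements
there is still a factor contributing mass at least `1` (`exists_factor_disjoint`). This contradicts
the Cauchy criterion for `∑ |ω̃|`. -/

theorem EllOne.sum_apply {α : Type*} (s : Finset α) (f : α → EllOne G) (x : G) :
    (∑ a ∈ s, f a) x = ∑ a ∈ s, f a x := by
  classical
  induction s using Finset.induction_on with
  | empty => simp
  | insert a s ha ih => simp [Finset.sum_insert ha, ih]

open Classical in
/-- The indicator function of a finite subgroup, as an element of `ℓ¹(G)`. -/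
noncomputable def subgroupIndicator (N : Subgroup G) [Finite N] : EllOne G :=
  EllOne.mk (fun y => if y ∈ N then 1 else 0)
    (summable_of_hasFiniteSupport ((Set.toFinite (N : Set G)).subset (fun y hy => by
      by_contra h
      exact hy (by simp [show y ∉ N from h]))))

open Classical in
theorem subgroupIndicator_apply (N : Subgroup G) [Finite N] (y : G) :
    subgroupIndicator N y = if y ∈ N then 1 else 0 := rfl

/-- A function supported on a finite subgroup is absorbed by its indicator function. -/
theorem mul_subgroupIndicator (N : Subgroup G) [Finite N] (f : EllOne G)
    (hf : ∀ y, y ∉ N → f y = 0) :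
    f * subgroupIndicator N = (∑' y, f y) • subgroupIndicator N := by
  classical
  ext z
  rw [EllOne.mul_apply, EllOne.smul_apply, ← tsum_mul_right]
  refine tsum_congr fun y => ?_
  by_cases hy : y ∈ N
  -- For `y ∈ N`, translation by `y⁻¹` preserves membership in `N`.
  · rw [subgroupIndicator_apply, subgroupIndicator_apply,
      if_congr (N.mul_mem_cancel_left (N.inv_mem hy)) rfl rfl]
  · rw [hf y hy, zero_mul, zero_mul]

theorem mem_of_mem_conjugatesOf {N : Subgroup G} [N.Normal] {x y : G} (hx : x ∈ N)
    (h : y ∈ conjugatesOf x) : y ∈ N := by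
  obtain ⟨c, rfl⟩ := isConj_iff.1 (show IsConj x y from h)
  exact Subgroup.Normal.conj_mem ‹_› x hx c

theorem ZEllOne.map_smul (ω : ZEllOne G →ₐ[ℂ] ℂ) (c : ℂ) (f : ZEllOne G) :
    ω (c • f) = c * ω f :=
  ω.toLinearMap.map_smul c f

variable [IsFCGroup G]

theorem ncard_conjugatesOf_ne_zero (x : G) : ((conjugatesOf x).ncard : ℂ) ≠ 0 :=
  Nat.cast_ne_zero.2
    (Set.ncard_ne_zero_of_mem mem_conjugatesOf_self (IsFCGroup.finite_conjugatesOf x))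

theorem tsum_classIndicator (x : G) :
    ∑' y, classIndicator x y = (conjugatesOf x).ncard := by
  classical
  have hfin := IsFCGroup.finite_conjugatesOf x
  rw [tsum_eq_sum (s := hfin.toFinset) (fun y hy => by
    rw [classIndicator_apply, if_neg (by simpa using hy)]),
    Finset.sum_congr rfl (g := fun _ => (1 : ℂ)) (fun y hy => by
      rw [classIndicator_apply, if_pos (by simpa using hy)]),
    Set.ncard_eq_toFinset_card _ hfin]
  simp

/-- The indicator function of a finite normal subgroup is the sum of the normalised class
indicators of its elements. -/
theorem subgroupIndicator_eq_sum (N : Subgroup G) [N.Normal] [Fintype N] :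
    subgroupIndicator N =
      ∑ x : N, ((conjugatesOf (x : G)).ncard : ℂ)⁻¹ • classIndicator (x : G) := by
  classical
  ext y
  rw [EllOne.sum_apply, subgroupIndicator_apply]
  simp only [EllOne.smul_apply, classIndicator_apply]
  by_cases hy : y ∈ N
  -- The weight is symmetric in `x` and `y`: conjugate elements have the same class. Summing over
  -- `x` then counts the class of `y`, all of which lies in `N` by normality.
  · have h1 : ∀ x : N, ((conjugatesOf (x : G)).ncard : ℂ)⁻¹ *
        (if y ∈ conjugatesOf (x : G) then 1 else 0) =
        ((conjugatesOf y).ncard : ℂ)⁻¹ * classIndicator y (x : G) := by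
      intro x
      rw [classIndicator_apply]
      by_cases h : IsConj (x : G) y
      · rw [if_pos (show y ∈ conjugatesOf (x : G) from h),
          if_pos (show (x : G) ∈ conjugatesOf y from h.symm), h.conjugatesOf_eq]
      · rw [if_neg (show y ∉ conjugatesOf (x : G) from h),
          if_neg (show (x : G) ∉ conjugatesOf y from fun k => h (IsConj.symm k)),
          mul_zero, mul_zero]
    have h2 : ∑ x : N, classIndicator y (x : G) = ∑' z, classIndicator y z := by
      rw [← tsum_fintype (L := .unconditional N)]
      refine tsum_subtype_eq_of_support_subset (s := (N : Set G)) fun z hz => ?_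
      by_contra hzN
      refine hz ?_
      rw [classIndicator_apply, if_neg (fun h => hzN (mem_of_mem_conjugatesOf hy h))]
    rw [if_pos hy, Finset.sum_congr rfl (fun x _ => h1 x), ← Finset.mul_sum, h2,
      tsum_classIndicator, inv_mul_cancel₀ (ncard_conjugatesOf_ne_zero y)]
  · rw [if_neg hy, Finset.sum_eq_zero]
    intro x _
    rw [if_neg (fun h => hy (mem_of_mem_conjugatesOf x.2 h)), mul_zero]

theorem subgroupIndicator_mem_center (N : Subgroup G) [N.Normal] [Finite N] :
    subgroupIndicator N ∈ ZEllOne G := by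
  have := Fintype.ofFinite N
  rw [subgroupIndicator_eq_sum]
  exact Subalgebra.sum_mem _ fun x _ =>
    Subalgebra.smul_mem _ (classIndicator_mem_center _) _

variable (ω : ZEllOne G →ₐ[ℂ] ℂ)

theorem characterFunction_one : characterFunction ω 1 = 1 := by
  have h : (⟨classIndicator (1 : G)⁻¹, classIndicator_mem_center _⟩ : ZEllOne G) = 1 := by
    classical
    refine Subtype.ext (EllOne.ext fun y => ?_)
    change _ = (1 : EllOne G) y
    rw [classIndicator_apply, EllOne.one_apply]
    refine if_congr ?_ rfl rfl
    rw [inv_one]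
    exact isConj_one_right
  have h' : conjugatesOf (1 : G)⁻¹ = {1} := by
    ext y
    rw [inv_one]
    exact isConj_one_right
  rw [characterFunction, h, map_one, h']
  simp

/-- The value of a character at the indicator function of a finite normal subgroup. -/
theorem map_subgroupIndicator (N : Subgroup G) [N.Normal] [Fintype N] :
    ω ⟨subgroupIndicator N, subgroupIndicator_mem_center N⟩ =
      ∑ x : N, characterFunction ω (x : G) := by
  have h : (⟨subgroupIndicator N, subgroupIndicator_mem_center N⟩ : ZEllOne G) =
      ∑ x : N, ((conjugatesOf (x : G)).ncard : ℂ)⁻¹ •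
        (⟨classIndicator (x : G), classIndicator_mem_center _⟩ : ZEllOne G) := by
    refine Subtype.ext ?_
    rw [AddSubmonoidClass.coe_finsetSum]
    exact subgroupIndicator_eq_sum N
  -- `characterFunction` at `x` uses the class of `x⁻¹`, so the sum is reindexed by inversion, which
  -- preserves `N`.
  rw [h, map_sum, ← Equiv.sum_comp (Equiv.inv N) (fun x : N => characterFunction ω (x : G))]
  refine Finset.sum_congr rfl fun x _ => ?_
  rw [ZEllOne.map_smul]
  simp [characterFunction]

/-- If a character does not vanish at the indicator function of a finite normal subgroup, then
its character function is `1` on that subgroup. -/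
theorem characterFunction_eq_one (N : Subgroup G) [N.Normal] [Finite N]
    (h : ω ⟨subgroupIndicator N, subgroupIndicator_mem_center N⟩ ≠ 0) {x : G} (hx : x ∈ N) :
    characterFunction ω x = 1 := by
  have key : (⟨classIndicator x⁻¹, classIndicator_mem_center x⁻¹⟩ : ZEllOne G) *
      ⟨subgroupIndicator N, subgroupIndicator_mem_center N⟩ =
      ((conjugatesOf x⁻¹).ncard : ℂ) •
        ⟨subgroupIndicator N, subgroupIndicator_mem_center N⟩ := by
    classical
    refine Subtype.ext ?_
    change classIndicator x⁻¹ * subgroupIndicator N = _ • subgroupIndicator N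
    rw [mul_subgroupIndicator, tsum_classIndicator]
    intro y hy
    rw [classIndicator_apply,
      if_neg (fun k => hy (mem_of_mem_conjugatesOf (N.inv_mem hx) k))]
  have key' := congrArg ω key
  rw [map_mul, ZEllOne.map_smul] at key'
  rw [characterFunction, mul_right_cancel₀ h key',
    inv_mul_cancel₀ (ncard_conjugatesOf_ne_zero _)]

/-- The bound does not depend on `N` or `ω`; this uniformity is what defeats summability. The two
cases are whether `ω` kills `1_N`. -/
theorem one_le_sum_norm_characterFunction [DecidableEq G] (N : Subgroup G) [N.Normal]
    [Fintype N] [Nontrivial N] :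
    1 ≤ ∑ x ∈ Finset.univ.erase (1 : N), ‖characterFunction ω (x : G)‖ := by
  by_cases h : ω ⟨subgroupIndicator N, subgroupIndicator_mem_center N⟩ = 0
  · rw [map_subgroupIndicator, ← Finset.add_sum_erase _ _ (Finset.mem_univ (1 : N)),
      Subgroup.coe_one, characterFunction_one] at h
    calc (1 : ℝ) = ‖∑ x ∈ Finset.univ.erase (1 : N), characterFunction ω (x : G)‖ := by
          rw [eq_neg_of_add_eq_zero_right h]
          simp
      _ ≤ _ := norm_sum_le _ _
  · obtain ⟨x, hx⟩ := exists_ne (1 : N)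
    calc (1 : ℝ) = ‖characterFunction ω (x : G)‖ := by
          rw [characterFunction_eq_one ω N h x.2, norm_one]
      _ ≤ _ := Finset.single_le_sum
          (f := fun x : N => ‖characterFunction ω (x : G)‖) (fun _ _ => norm_nonneg _)
          (Finset.mem_erase.2 ⟨hx, Finset.mem_univ x⟩)

end FiniteNormalSubgroup

/-! ### Factors of a restricted direct product. -/

namespace RestrictedDirectProduct

variable {ι : Type*} (G : ι → Type*) [∀ i, Group (G i)]

/-- The `i`-th factor of a restricted direct product, as a subgroup. -/
def factor (i : ι) : Subgroup (RestrictedDirectProduct G) where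
  carrier := {x | ∀ j, j ≠ i → x j = 1}
  one_mem' _ _ := rfl
  mul_mem' {x y} hx hy j hj := by simp [hx j hj, hy j hj]
  inv_mem' {x} hx j hj := by simp [hx j hj]

variable {G}

instance (i : ι) : (factor G i).Normal where
  conj_mem x hx c j hj := by simp [hx j hj]

instance (i : ι) [Finite (G i)] : Finite (factor G i) := by
  refine Finite.of_injective (fun x : factor G i => (x : RestrictedDirectProduct G) i) ?_
  intro x y hxy
  ext j
  by_cases hj : j = i
  · subst hj
    exact hxy
  · rw [x.2 j hj, y.2 j hj]

instance (i : ι) [Nontrivial (G i)] : Nontrivial (factor G i) := by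
  classical
  obtain ⟨g, hg⟩ := exists_ne (1 : G i)
  have hfin : ∀ᶠ j in Filter.cofinite,
      Pi.mulSingle i g j ∈ ((⊥ : Subgroup (G j)) : Set (G j)) := by
    rw [Filter.eventually_cofinite]
    refine (Set.finite_singleton i).subset fun j hj => ?_
    by_contra hne
    exact hj (by simp [Pi.mulSingle_eq_of_ne (show j ≠ i from hne)])
  refine ⟨⟨⟨⟨Pi.mulSingle i g, hfin⟩, fun j hj => Pi.mulSingle_eq_of_ne hj g⟩, 1, ?_⟩⟩
  intro h
  have h' := congrArg (fun x : factor G i => (x : RestrictedDirectProduct G) i) h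
  exact hg ((Pi.mulSingle_eq_same i g).symm.trans h')

/-- Trivial factors carry no information, so with finitely many nontrivial ones the group would
embed in a finite product of finite groups. -/
theorem infinite_setOf_nontrivial [∀ i, Finite (G i)] [Infinite (RestrictedDirectProduct G)] :
    {i | Nontrivial (G i)}.Infinite := by
  intro hfin
  have : Finite {i | Nontrivial (G i)} := hfin
  refine not_finite_iff_infinite.2 ‹Infinite (RestrictedDirectProduct G)› ?_
  refine Finite.of_injective
    (fun (x : RestrictedDirectProduct G) (i : {i | Nontrivial (G i)}) => x i.1) ?_
  intro x y hxy
  ext i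
  by_cases hi : Nontrivial (G i)
  · exact congrFun hxy ⟨i, hi⟩
  · have := not_nontrivial_iff_subsingleton.1 hi
    exact Subsingleton.elim _ _

/-- A finite set meets only finitely many of the factors outside the identity. -/
theorem exists_factor_disjoint [∀ i, Finite (G i)] [Infinite (RestrictedDirectProduct G)]
    (s : Finset (RestrictedDirectProduct G)) :
    ∃ i, Nontrivial (G i) ∧ ∀ x ∈ factor G i, x ≠ 1 → x ∉ s := by
  -- Elements of `s` have finite support; any nontrivial index outside the union of these supports
  -- works.
  have hfin : (⋃ x ∈ s, {i | x i ≠ 1}).Finite :=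
    s.finite_toSet.biUnion fun x _ => Filter.eventually_cofinite.1 x.2
  obtain ⟨i, hi, hi'⟩ := (infinite_setOf_nontrivial (G := G)).exists_notMem_finite hfin
  refine ⟨i, hi, fun x hx hx1 hxs => hx1 ?_⟩
  ext j
  by_cases hj : j = i
  · subst hj
    by_contra h
    exact hi' (Set.mem_biUnion hxs h)
  · exact hx j hj

end RestrictedDirectProduct

theorem mainTheorem7 {ι : Type*} (G : ι → Type*) [∀ i, Group (G i)] [∀ i, Finite (G i)]
    [Infinite (RestrictedDirectProduct G)]
    (ω : ZEllOne (RestrictedDirectProduct G) →ₐ[ℂ] ℂ) :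
    ¬ Memℓp (characterFunction ω) 1 := by
  classical
  intro hω
  -- The tolerance `1` is exactly the mass that each nontrivial factor is known to carry off the
  -- identity.
  obtain ⟨s, hs⟩ := summable_iff_vanishing_norm.1 (EllOne.memlp_one_iff.1 hω) 1 one_pos
  obtain ⟨i, hi, hd⟩ := RestrictedDirectProduct.exists_factor_disjoint s
  let N := RestrictedDirectProduct.factor G i
  have := Fintype.ofFinite N
  have hlt := hs ((Finset.univ.erase (1 : N)).map (Function.Embedding.subtype _)) (by
    rw [Finset.disjoint_left]
    intro x hx
    obtain ⟨y, hy, rfl⟩ := Finset.mem_map.1 hx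
    exact hd y y.2 (fun h => Finset.ne_of_mem_erase hy (Subtype.ext h)))
  rw [Finset.sum_map] at hlt
  exact absurd ((le_abs_self _).trans_lt hlt)
    (not_lt.2 (one_le_sum_norm_characterFunction ω N))
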